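/- Let $(A_i)_{i\in\mathbb N}$ be a sequence of finite sets with $|A_i|\ge 2$ for all $i$. Let $T$ be the rooted tree whose vertices are the finite words $a_0a_1\cdots a_{k-1}$ ($k\ge 0$, $a_i\in A_i$), whose root is the empty word, and in which $v$ and $w$ are joined by an edge whenever $v$ is a prefix of $w$ and $|w|=|v|+1$ or vice versa; here $|v|$ denotes the length of the word $v$. Let $\mathrm{Aut}(T)$ be the group of graph automorphisms of $T$ that fix the root. For a subgroup $G\le\mathrm{Aut}(T)$, the rigid stabiliser of a vertex $v$ is $\mathrm{rist}_G(v)=\{g\in G : gw=w \text{ for every vertex } w \text{ that does not have } v \text{ as a prefix}\}$, and $\mathrm{rist}_G(n)$ is the subgroup of $G$ generated by all $\mathrm{rist}_G(v)$ with $|v|=n$. The group $G$ is called a branch group if, for every $n\in\mathbb N$, $G$ acts transitively on the set of vertices of length $n$ and $\mathrm{rist}_G(n)$ has finite index in $G$. **Theorem.** Let $G\le\mathrm{Aut}(T)$ be a branch group and let $H\le G$ be a subgroup of finite bi-index, i.e. such that the set $H\backslash G/H$ of double cosets is finite. Then $H$ has finite index in $G$. In other words, branch groups have property $BF$: every subgroup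 of finite bi-index has finite index. -/

import Mathlib

universe u

/-- A vertex of the spherically homogeneous rooted tree given by a sequence of alphabets `A`:
a word `(a_0, ..., a_{k-1})` with `a_i ∈ A i`, where `k` is the length of the word. -/
structure TreeVertex (A : ℕ → Type u) where
  /-- The length of the word. -/
  length : ℕ
  /-- The letters of the word. -/
  letter : ∀ i : Fin length, A i

namespace TreeVertex

variable {A : ℕ → Type u}

/-- The empty word, root of the tree. -/
def root (A : ℕ → Type u) : TreeVertex A := ⟨0, fun i => i.elim0⟩

/-- The order on words: `v ≤ w` when `v` is a prefix of `w`, that is, when `w` is a descendant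
of `v`. -/
instance : LE (TreeVertex A) where
  le v w := ∃ h : v.length ≤ w.length, ∀ i : Fin v.length, w.letter (Fin.castLE h i) = v.letter i

instance : PartialOrder (TreeVertex A) where
  le_refl v := ⟨le_rfl, fun _ => rfl⟩
  le_trans _ _ _ h₁ h₂ := by
    obtain ⟨l₁, e₁⟩ := h₁
    obtain ⟨l₂, e₂⟩ := h₂
    exact ⟨l₁.trans l₂, fun i => (e₂ (Fin.castLE l₁ i)).trans (e₁ i)⟩
  le_antisymm v w h₁ h₂ := by
    obtain ⟨k, a⟩ := v
    obtain ⟨l, b⟩ := w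
    obtain ⟨l₁, e₁⟩ := h₁
    obtain ⟨l₂, e₂⟩ := h₂
    obtain rfl : k = l := le_antisymm l₁ l₂
    have hab : a = b := funext fun i => (e₁ i).symm
    rw [hab]

end TreeVertex

/-- The (underlying graph of the) spherically homogeneous rooted tree given by the alphabets `A`:
the edges are the pairs `{v, w}` where `v` is a prefix of `w` and `|w| = |v| + 1`. -/
def rootedTree (A : ℕ → Type u) : SimpleGraph (TreeVertex A) where
  Adj v w := (v ≤ w ∧ w.length = v.length + 1) ∨ (w ≤ v ∧ v.length = w.length + 1)
  symm := ⟨fun _ _ h => h.symm⟩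
  loopless := ⟨fun v h => by rcases h with h | h <;> omega⟩

/-- The group `Aut(T)`: automorphisms of the graph that fix the root. -/
def rootedTreeAut (A : ℕ → Type u) : Subgroup (rootedTree A ≃g rootedTree A) where
  carrier := {f | f (TreeVertex.root A) = TreeVertex.root A}
  one_mem' := rfl
  mul_mem' {f g} hf hg := by
    change f (g (TreeVertex.root A)) = TreeVertex.root A
    rw [hg, hf]
  inv_mem' {f} hf := by
    change f.symm (TreeVertex.root A) = TreeVertex.root A
    rw [RelIso.symm_apply_eq]
    exact hf.symm

section Branch

variable {A : ℕ → Type u}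

/-- `G` acts spherically transitively: its action on every level of the tree is transitive. -/
def SphericallyTransitive (G : Subgroup (rootedTreeAut A)) : Prop :=
  ∀ n : ℕ, ∀ v w : TreeVertex A, v.length = n → w.length = n → ∃ g : G, g • v = w

/-- The rigid stabiliser of the vertex `v` in `G`: the elements of `G` that fix every vertex
which is not a descendant of `v`. -/
def rist (G : Subgroup (rootedTreeAut A)) (v : TreeVertex A) : Subgroup G where
  carrier := {g | ∀ w : TreeVertex A, ¬ v ≤ w → g • w = w}
  one_mem' w _ := one_smul G w
  mul_mem' {g h} hg hh w hw := by rw [mul_smul, hh w hw, hg w hw]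
  inv_mem' {g} hg w hw := by rw [inv_smul_eq_iff, hg w hw]

/-- The rigid stabiliser of the `n`-th level: the subgroup of `G` generated by the rigid
stabilisers of all vertices of length `n`. -/
def levelRist (G : Subgroup (rootedTreeAut A)) (n : ℕ) : Subgroup G :=
  ⨆ (v : TreeVertex A) (_ : v.length = n), rist G v

/-- `G` is a branch group: it acts spherically transitively, and the rigid stabiliser of every
level has finite index in `G`. -/
structure IsBranchGroup (G : Subgroup (rootedTreeAut A)) : Prop where
  sphericallyTransitive : SphericallyTransitive G
  finiteIndex_levelRist : ∀ n : ℕ, (levelRist G n).FiniteIndex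

end Branch

/-- A subgroup `H` has finite bi-index if the set `H \ G / H` of its double cosets is finite. -/
def Subgroup.FiniteBiIndex {G : Type u} [Group G] (H : Subgroup G) : Prop :=
  Finite (DoubleCoset.Quotient (H : Set G) (H : Set G))

/-- Property `BF`: every subgroup of finite bi-index has finite index. -/
def PropertyBF (G : Type u) [Group G] : Prop :=
  ∀ H : Subgroup G, H.FiniteBiIndex → H.FiniteIndex

/-! ### Words, prefixes and levels of the tree. -/

namespace TreeVertex

variable {A : ℕ → Type u}

/-! Suppose `H` has finite bi-index and infinite index. Only finitely many subgroups contain `H`, so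
the groups `H ⊔ levelRist G n` stabilise to one finite-index subgroup `K` (`exists_sup_eq`).

Call a vertex `s` of level `n` bad if some element of its rigid stabiliser does not act below `s`
like an element of `H ⊓ levelRist G n`. The number of bad vertices is less than the number of double
cosets (`ncard_badVertices_lt`), but for large `n` the bad set is `K`-invariant, so if nonempty it
has at least `2 ^ n / [G : K]` elements. Hence deep levels have no bad vertices, and there `K`
conjugates `H ∩ rist G s` into `H` (`conj_mem_of_badVertices_eq_empty`).

These intersections are nontrivial (`exists_mem_rist_ne_one`), so the largest subgroup of `H`
normalised by `K` acts nontrivially below every vertex. It then moves every vertex of some level `m`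
and contains the commutators of `levelRist G m` (`commutator_mem_of_smul_ne`). Finite bi-index now
forces finite index (`finiteIndex_of_commutator_mem`), a contradiction. -/

theorem length_le_of_le {v w : TreeVertex A} (h : v ≤ w) : v.length ≤ w.length := h.1

theorem le_of_le_of_le_of_length_le {v v' w : TreeVertex A} (h : v ≤ w) (h' : v' ≤ w)
    (hl : v.length ≤ v'.length) : v ≤ v' := by
  obtain ⟨l, e⟩ := h
  obtain ⟨l', e'⟩ := h'
  exact ⟨hl, fun i => (e' (Fin.castLE hl i)).symm.trans (e i)⟩

theorem eq_of_le_of_le_of_length_eq {v v' w : TreeVertex A} (h : v ≤ w) (h' : v' ≤ w)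
    (hl : v.length = v'.length) : v = v' :=
  le_antisymm (le_of_le_of_le_of_length_le h h' hl.le) (le_of_le_of_le_of_length_le h' h hl.ge)

theorem eq_of_le_of_length_eq {v w : TreeVertex A} (h : v ≤ w) (hl : v.length = w.length) :
    v = w :=
  eq_of_le_of_le_of_length_eq h le_rfl hl

theorem exists_le_length_eq (w : TreeVertex A) {n : ℕ} (hn : n ≤ w.length) :
    ∃ v ≤ w, v.length = n :=
  ⟨⟨n, fun i => w.letter (Fin.castLE hn i)⟩, ⟨hn, fun _ => rfl⟩, rfl⟩

theorem eq_root_of_length_eq_zero {v : TreeVertex A} (h : v.length = 0) : v = root A := by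
  have : root A ≤ v := ⟨Nat.zero_le _, fun i => i.elim0⟩
  exact (eq_of_le_of_length_eq this h.symm).symm

theorem exists_ge_length_eq [∀ i, Nonempty (A i)] (v : TreeVertex A) {n : ℕ} (hn : v.length ≤ n) :
    ∃ w, v ≤ w ∧ w.length = n :=
  ⟨⟨n, fun i => if h : i.1 < v.length then v.letter ⟨i, h⟩ else Classical.arbitrary _⟩,
    ⟨hn, fun i => by simp⟩, rfl⟩

/-- The vertices of a given length are the words of that length. -/
def levelEquiv (A : ℕ → Type u) (n : ℕ) :
    {v : TreeVertex A // v.length = n} ≃ ∀ i : Fin n, A i where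
  toFun v := fun i => v.1.letter (Fin.cast v.2.symm i)
  invFun a := ⟨⟨n, a⟩, rfl⟩
  left_inv := by rintro ⟨⟨k, a⟩, rfl⟩; rfl
  right_inv _ := rfl

instance finite_level [∀ i, Finite (A i)] (n : ℕ) : Finite {v : TreeVertex A // v.length = n} :=
  Finite.of_equiv _ (levelEquiv A n).symm

theorem two_pow_le_card_level (hA : ∀ i, 2 ≤ Nat.card (A i)) (n : ℕ) :
    2 ^ n ≤ Nat.card {v : TreeVertex A // v.length = n} := by
  rw [Nat.card_congr (levelEquiv A n), Nat.card_pi]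
  calc 2 ^ n = ∏ _i : Fin n, 2 := by simp
    _ ≤ _ := Finset.prod_le_prod' fun i _ => hA i

end TreeVertex

/-! ### Automorphisms preserve levels and prefixes; rigid stabilisers. -/

section Automorphisms

variable {A : ℕ → Type u}

open TreeVertex

theorem rootedTree_adj {v w : TreeVertex A} : (rootedTree A).Adj v w ↔
    (v ≤ w ∧ w.length = v.length + 1) ∨ (w ≤ v ∧ v.length = w.length + 1) := Iff.rfl

theorem length_rootedTreeAut_apply {f : rootedTree A ≃g rootedTree A} (hf : f ∈ rootedTreeAut A)
    (v : TreeVertex A) : (f v).length = v.length := by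
  have hroot : f (root A) = root A := hf
  induction hk : v.length using Nat.strong_induction_on generalizing v with
  | _ k ih =>
    obtain rfl | hpos := Nat.eq_zero_or_pos k
    · rw [eq_root_of_length_eq_zero hk, hroot]; rfl
    obtain ⟨p, hpv, hp⟩ := v.exists_le_length_eq (n := k - 1) (by omega)
    have hfp := ih (k - 1) (by omega) p hp
    have hadj : (rootedTree A).Adj (f p) (f v) :=
      f.map_rel_iff.2 (rootedTree_adj.2 (Or.inl ⟨hpv, by omega⟩))
    obtain ⟨-, h⟩ | ⟨hle, h⟩ := rootedTree_adj.1 hadj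
    · omega
    -- Otherwise `f v` would be the parent of `f p`; but so is the image of the grandparent `q` of
    -- `v`, against injectivity.
    exfalso
    obtain ⟨q, hqp, hq⟩ := p.exists_le_length_eq (n := k - 2) (by omega)
    have hfq := ih (k - 2) (by omega) q hq
    have hadj' : (rootedTree A).Adj (f q) (f p) :=
      f.map_rel_iff.2 (rootedTree_adj.2 (Or.inl ⟨hqp, by omega⟩))
    obtain ⟨hle', h'⟩ | ⟨-, h'⟩ := rootedTree_adj.1 hadj'
    · have := f.injective (eq_of_le_of_le_of_length_eq hle hle' (by omega))
      rw [this] at hk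
      omega
    · omega

theorem rootedTreeAut_apply_le_apply {f : rootedTree A ≃g rootedTree A}
    (hf : f ∈ rootedTreeAut A) {v w : TreeVertex A} (h : v ≤ w) : f v ≤ f w := by
  induction hk : w.length using Nat.strong_induction_on generalizing w with
  | _ k ih =>
    obtain heq | hlt := (length_le_of_le h).eq_or_lt
    · rw [eq_of_le_of_length_eq h heq]
    obtain ⟨p, hpw, hp⟩ := w.exists_le_length_eq (n := k - 1) (by omega)
    refine (ih (k - 1) (by omega)
      (le_of_le_of_le_of_length_le h hpw (by omega)) hp).trans ?_
    have hadj : (rootedTree A).Adj (f p) (f w) :=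
      f.map_rel_iff.2 (rootedTree_adj.2 (Or.inl ⟨hpw, by omega⟩))
    have h₁ := length_rootedTreeAut_apply hf p
    have h₂ := length_rootedTreeAut_apply hf w
    obtain ⟨hle, -⟩ | ⟨-, h⟩ := rootedTree_adj.1 hadj
    · exact hle
    · omega

variable {G : Subgroup (rootedTreeAut A)}

@[simp]
theorem length_smul (g : G) (v : TreeVertex A) : (g • v).length = v.length :=
  length_rootedTreeAut_apply g.1.2 v

theorem smul_le_smul_of_le (g : G) {v w : TreeVertex A} (h : v ≤ w) : g • v ≤ g • w :=
  rootedTreeAut_apply_le_apply g.1.2 h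

theorem smul_le_smul_vertex_iff (g : G) {v w : TreeVertex A} : g • v ≤ g • w ↔ v ≤ w :=
  ⟨fun h => by simpa using smul_le_smul_of_le g⁻¹ h, smul_le_smul_of_le g⟩

theorem eq_of_forall_smul_eq {g h : G} (H : ∀ w : TreeVertex A, g • w = h • w) : g = h :=
  Subtype.ext (Subtype.ext (RelIso.ext H))

theorem mem_rist {v : TreeVertex A} {g : G} :
    g ∈ rist G v ↔ ∀ w : TreeVertex A, ¬ v ≤ w → g • w = w := Iff.rfl

theorem smul_eq_self_of_mem_rist {v : TreeVertex A} {g : G} (hg : g ∈ rist G v) : g • v = v := by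
  by_contra hne
  have : ¬ v ≤ g • v := fun h => hne (eq_of_le_of_length_eq h (length_smul g v).symm).symm
  exact hne (MulAction.injective g (mem_rist.1 hg _ this))

theorem conj_mem_rist {v : TreeVertex A} {x : G} (g : G) (hx : x ∈ rist G v) :
    g * x * g⁻¹ ∈ rist G (g • v) := by
  intro w hw
  rw [mul_smul, mul_smul, mem_rist.1 hx, smul_inv_smul]
  intro h
  exact hw (by simpa using smul_le_smul_of_le g h)

theorem rist_le_rist_of_le {v w : TreeVertex A} (h : v ≤ w) : rist G w ≤ rist G v :=
  fun _ hg _ hu => hg _ fun hwu => hu (h.trans hwu)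

/-- An element of the rigid stabiliser of `v` commutes with the elements fixing all the
descendants of `v`. -/
theorem commute_of_mem_rist {v : TreeVertex A} {c z : G} (hc : c ∈ rist G v)
    (hz : ∀ w, v ≤ w → z • w = w) : Commute z c := by
  refine eq_of_forall_smul_eq fun w => ?_
  rw [mul_smul, mul_smul]
  by_cases hw : v ≤ w
  · have : v ≤ c • w := by
      have := smul_le_smul_of_le c hw
      rwa [smul_eq_self_of_mem_rist hc] at this
    rw [hz _ hw, hz _ this]
  · rw [mem_rist.1 hc _ hw, mem_rist.1 hc]
    intro h
    rw [← hz v le_rfl] at h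
    exact hw ((smul_le_smul_vertex_iff z).1 h)

theorem smul_eq_self_of_mem_rist_of_ne {s t w : TreeVertex A} {x : G} (hx : x ∈ rist G t)
    (hl : s.length = t.length) (hne : s ≠ t) (hw : s ≤ w) : x • w = w :=
  mem_rist.1 hx _ fun h => hne (eq_of_le_of_le_of_length_eq hw h hl)

theorem commute_of_mem_rist_of_ne {s t : TreeVertex A} {x y : G} (hx : x ∈ rist G s)
    (hy : y ∈ rist G t) (hl : s.length = t.length) (hne : s ≠ t) : Commute x y :=
  (commute_of_mem_rist hx fun _ hw => smul_eq_self_of_mem_rist_of_ne hy hl hne hw).symm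

theorem rist_le_levelRist {v : TreeVertex A} {n : ℕ} (hv : v.length = n) :
    rist G v ≤ levelRist G n :=
  le_iSup₂_of_le v hv le_rfl

theorem levelRist_le_iff {n : ℕ} {J : Subgroup G} :
    levelRist G n ≤ J ↔ ∀ v : TreeVertex A, v.length = n → rist G v ≤ J :=
  iSup₂_le_iff

theorem levelRist_antitone : Antitone (levelRist G) := by
  intro n m hnm
  rw [levelRist_le_iff]
  intro w hw
  obtain ⟨v, hvw, hv⟩ := w.exists_le_length_eq (n := n) (by omega)
  exact (rist_le_rist_of_le hvw).trans (rist_le_levelRist hv)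

instance levelRist_normal (n : ℕ) : (levelRist G n).Normal := by
  refine ⟨fun x hx g => ?_⟩
  have : levelRist G n ≤ (levelRist G n).comap (MulAut.conj g).toMonoidHom := by
    rw [levelRist_le_iff]
    intro v hv x hx
    exact rist_le_levelRist (by simpa using hv) (conj_mem_rist g hx)
  exact this hx

theorem smul_eq_self_of_mem_levelRist {n : ℕ} {x : G} (hx : x ∈ levelRist G n) {v : TreeVertex A}
    (hv : v.length = n) : x • v = v := by
  have : levelRist G n ≤ MulAction.stabilizer G v := by
    rw [levelRist_le_iff]
    intro w hw y hy
    by_cases hne : v = w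
    · rw [hne]
      exact smul_eq_self_of_mem_rist hy
    · exact smul_eq_self_of_mem_rist_of_ne hy (hv.trans hw.symm) hne le_rfl
  exact this hx

theorem le_smul_of_mem_levelRist {n : ℕ} {x : G} (hx : x ∈ levelRist G n) {v w : TreeVertex A}
    (hv : v.length = n) (hw : v ≤ w) : v ≤ x • w := by
  have := smul_le_smul_of_le x hw
  rwa [smul_eq_self_of_mem_levelRist hx hv] at this

end Automorphisms

/-! ### Subgroups of finite bi-index in an arbitrary group. -/

section DoubleCosets

variable {G : Type u} [Group G] {H : Subgroup G}

/-- If every element of a finite index subgroup lies in one of finitely many left cosets of `H`,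
then `H` has finite index. -/
theorem Subgroup.finiteIndex_of_subset_mul {M : Subgroup G} [M.FiniteIndex] {F : Set G}
    (hF : F.Finite) (h : ∀ x ∈ M, ∃ f ∈ F, f⁻¹ * x ∈ H) : H.FiniteIndex := by
  have : Finite F := hF
  have hsurj : Function.Surjective
      fun p : (G ⧸ M) × F => ((p.1.out * p.2.1 : G) : G ⧸ H) := by
    intro q
    induction q using QuotientGroup.induction_on with
    | H g =>
      obtain ⟨f, hf, hfH⟩ := h ((g : G ⧸ M).out⁻¹ * g)
        (QuotientGroup.eq.1 (QuotientGroup.out_eq' (g : G ⧸ M)))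
      refine ⟨((g : G ⧸ M), ⟨f, hf⟩), QuotientGroup.eq.2 ?_⟩
      simpa [mul_assoc] using hfH
  have := Finite.of_surjective _ hsurj
  exact Subgroup.finiteIndex_of_finite_quotient

/-- A finite index subgroup `M` is the union of finitely many double cosets of `H ⊓ M`, if `H` has
finite bi-index. -/
theorem Subgroup.FiniteBiIndex.exists_finite_inf (hH : H.FiniteBiIndex) (M : Subgroup G)
    [M.FiniteIndex] : ∃ F : Set G, F.Finite ∧ F ⊆ M ∧
      ∀ x ∈ M, ∃ f ∈ F, ∃ h ∈ H ⊓ M, ∃ k ∈ H ⊓ M, x = h * f * k := by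
  have : Finite (DoubleCoset.Quotient (H : Set G) (H : Set G)) := hH
  have hT : ∃ T : Set G, T.Finite ∧ T ⊆ H ∧ ∀ h ∈ H, ∃ t ∈ T, t⁻¹ * h ∈ M := by
    let q : H → G ⧸ M := fun h => (h.1 : G ⧸ M)
    refine ⟨Set.range fun y : Set.range q => (Set.rangeSplitting q y).1, Set.finite_range _, ?_, ?_⟩
    · rintro _ ⟨y, rfl⟩
      exact (Set.rangeSplitting q y).2
    · intro h hh
      refine ⟨_, ⟨⟨q ⟨h, hh⟩, ⟨_, rfl⟩⟩, rfl⟩, QuotientGroup.eq.1 ?_⟩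
      exact Set.apply_rangeSplitting q ⟨q ⟨h, hh⟩, ⟨_, rfl⟩⟩
  obtain ⟨T, hTfin, hTH, hT⟩ := hT
  let D : Set G := Set.range fun q : DoubleCoset.Quotient (H : Set G) (H : Set G) => q.out
  have hD : D.Finite := Set.finite_range _
  -- Correcting the representatives in `D` on both sides by elements of `T ⊆ H` brings the outer
  -- factors into `M`.
  refine ⟨(fun p : (G × G) × G => p.1.1⁻¹ * p.2 * p.1.2) '' ((T ×ˢ T) ×ˢ D) ∩ M,
    (((hTfin.prod hTfin).prod hD).image _).inter_of_left _, Set.inter_subset_right, ?_⟩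
  intro x hx
  obtain ⟨h, k, hh, hk, e⟩ := DoubleCoset.mk_out_eq_mul H H x
  obtain ⟨t, htT, ht⟩ := hT h hh
  obtain ⟨s, hsT, hs⟩ := hT k⁻¹ (H.inv_mem hk)
  have hsk : k * s ∈ M := by simpa only [mul_inv_rev, inv_inv] using M.inv_mem hs
  have hf : t⁻¹ * (DoubleCoset.mk H H x).out * s = (t⁻¹ * h) * x * (k * s) := by
    rw [e]; group
  refine ⟨t⁻¹ * (DoubleCoset.mk H H x).out * s, ⟨⟨((t, s), _), ⟨⟨htT, hsT⟩, ⟨_, rfl⟩⟩, rfl⟩, ?_⟩,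
    (t⁻¹ * h)⁻¹, ?_, (k * s)⁻¹, ?_, ?_⟩
  · rw [hf]
    exact mul_mem (mul_mem ht hx) hsk
  · exact (H ⊓ M).inv_mem ⟨H.mul_mem (H.inv_mem (hTH htT)) hh, ht⟩
  · exact (H ⊓ M).inv_mem ⟨H.mul_mem hk (hTH hsT), hsk⟩
  · rw [hf]; group

/-- A subgroup of finite bi-index which contains the commutators of a finite index subgroup has
finite index. -/
theorem Subgroup.FiniteBiIndex.finiteIndex_of_commutator_mem (hH : H.FiniteBiIndex)
    (M : Subgroup G) [M.FiniteIndex] (hM : ∀ x ∈ M, ∀ y ∈ M, x * y * x⁻¹ * y⁻¹ ∈ H) :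
    H.FiniteIndex := by
  obtain ⟨F, hF, hFM, h⟩ := hH.exists_finite_inf M
  refine Subgroup.finiteIndex_of_subset_mul (M := M) hF fun x hx => ?_
  obtain ⟨f, hf, h, hh, k, hk, rfl⟩ := h x hx
  refine ⟨f, hf, ?_⟩
  -- `f⁻¹ h f k = [f⁻¹, h] · h k`, so the double coset of `f` collapses into the left coset `f H`.
  have := mul_mem (mul_mem (hM f⁻¹ (inv_mem (hFM hf)) h hh.2) hh.1) hk.1
  simpa [mul_assoc] using this

/-- There are finitely many subgroups above a subgroup of finite bi-index. -/
theorem Subgroup.FiniteBiIndex.finite_setOf_le (hH : H.FiniteBiIndex) :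
    {J : Subgroup G | H ≤ J}.Finite := by
  have : Finite (DoubleCoset.Quotient (H : Set G) (H : Set G)) := hH
  refine Set.Finite.of_injOn (t := Set.univ)
    (f := fun J : Subgroup G => DoubleCoset.mk H H '' (J : Set G)) (fun _ _ => Set.mem_univ _) ?_
    Set.finite_univ
  -- A subgroup containing `H` is a union of double cosets, hence determined by its image.
  have key : ∀ J J' : Subgroup G, H ≤ J' →
      DoubleCoset.mk H H '' (J : Set G) = DoubleCoset.mk H H '' (J' : Set G) → J ≤ J' := by
    intro J J' hJ' e x hx
    have hx' : DoubleCoset.mk H H x ∈ DoubleCoset.mk H H '' (J' : Set G) := by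
      rw [← e]
      exact Set.mem_image_of_mem _ hx
    obtain ⟨y, hy, hyx⟩ := hx'
    obtain ⟨h, hh, k, hk, rfl⟩ := (DoubleCoset.eq H H y x).1 hyx
    exact mul_mem (mul_mem (hJ' hh) hy) (hJ' hk)
  intro J hJ J' hJ' e
  exact le_antisymm (key J J' hJ' e) (key J' J hJ e.symm)

/-- A decreasing sequence with finitely many values is eventually constant. For rigid level
stabilisers this lets an element of `K` be written as `h * l` with `l` as deep as desired. -/
theorem Subgroup.FiniteBiIndex.exists_sup_eq (hH : H.FiniteBiIndex) {L : ℕ → Subgroup G}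
    (hL : Antitone L) : ∃ n₀, ∀ n ≥ n₀, H ⊔ L n = H ⊔ L n₀ := by
  have hfin : (Set.range fun n => H ⊔ L n).Finite :=
    hH.finite_setOf_le.subset (by rintro _ ⟨n, rfl⟩; exact (le_sup_left : H ≤ H ⊔ L n))
  obtain ⟨J, hJ⟩ := hfin.exists_minimal (Set.range_nonempty _)
  obtain ⟨n₀, rfl⟩ := hJ.1
  refine ⟨n₀, fun n hn => ?_⟩
  exact (hJ.eq_of_le ⟨n, rfl⟩ (sup_le_sup_left (hL hn) H))

/-- The elements of `H` all of whose conjugates by elements of `K` belong to `H`. -/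
def relativeCore (H K : Subgroup G) : Subgroup G where
  carrier := {x | ∀ k ∈ K, k * x * k⁻¹ ∈ H}
  one_mem' k _ := by simp
  mul_mem' {x y} hx hy k hk := by simpa [mul_assoc] using mul_mem (hx k hk) (hy k hk)
  inv_mem' {x} hx k hk := by simpa [mul_assoc] using inv_mem (hx k hk)

theorem mem_relativeCore {K : Subgroup G} {x : G} :
    x ∈ relativeCore H K ↔ ∀ k ∈ K, k * x * k⁻¹ ∈ H := Iff.rfl

theorem relativeCore_le (H K : Subgroup G) : relativeCore H K ≤ H := fun x hx => by
  simpa using hx 1 (one_mem K)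

theorem conj_mem_relativeCore {K : Subgroup G} {x k : G} (hx : x ∈ relativeCore H K)
    (hk : k ∈ K) : k * x * k⁻¹ ∈ relativeCore H K := fun l hl => by
  simpa [mul_assoc] using hx (l * k) (mul_mem hl hk)

/-- If `N` is normalised by `K`, the elements of `K` commuting with `y` modulo `N` form a
subgroup. -/
def relativeCentralizer (N K : Subgroup G) (hN : ∀ x ∈ N, ∀ k ∈ K, k * x * k⁻¹ ∈ N) (y : G) :
    Subgroup G where
  carrier := {x | x ∈ K ∧ x * y * x⁻¹ * y⁻¹ ∈ N}
  one_mem' := by simp [one_mem]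
  mul_mem' {a b} ha hb :=
    ⟨mul_mem ha.1 hb.1, by simpa [mul_assoc] using mul_mem (hN _ hb.2 a ha.1) ha.2⟩
  inv_mem' {a} ha :=
    ⟨inv_mem ha.1, by
      simpa [mul_assoc] using hN _ (inv_mem ha.2) a⁻¹ (inv_mem ha.1)⟩

end DoubleCosets

/-! ### Commutators and moved levels for subgroups normalised by `K`. -/

section BranchGroups

variable {A : ℕ → Type u} {G : Subgroup (rootedTreeAut A)}

open TreeVertex

theorem smul_ne_self_of_le {g : G} {v w : TreeVertex A} (h : v ≤ w) (hg : g • v ≠ v) :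
    g • w ≠ w := fun e => hg <| by
  have := smul_le_smul_of_le g h
  rw [e] at this
  exact eq_of_le_of_le_of_length_eq this h (length_smul g v)

theorem exists_smul_ne_of_ne_one {g : G} (hg : g ≠ 1) : ∃ w : TreeVertex A, g • w ≠ w := by
  by_contra! h
  exact hg (eq_of_forall_smul_eq fun w => by rw [h, one_smul])

/-- A subgroup normalised by `K ≥ rist_G(m)` which moves all the vertices of level `m` contains
the commutators of the rigid stabiliser of that level. -/
theorem commutator_mem_of_smul_ne {N K : Subgroup G} (hN : ∀ x ∈ N, ∀ k ∈ K, k * x * k⁻¹ ∈ N)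
    {m : ℕ} (hK : levelRist G m ≤ K)
    (hmove : ∀ w : TreeVertex A, w.length = m → ∃ g ∈ N, g • w ≠ w) :
    ∀ x ∈ levelRist G m, ∀ y ∈ levelRist G m, x * y * x⁻¹ * y⁻¹ ∈ N := by
  have h₁ : ∀ w : TreeVertex A, w.length = m → ∀ a ∈ rist G w, ∀ b ∈ rist G w,
      a * b * a⁻¹ * b⁻¹ ∈ N := by
    intro w hw a ha b hb
    obtain ⟨g, hg, hgw⟩ := hmove w hw
    have ha' := hK (rist_le_levelRist hw ha)
    have hb' := hK (rist_le_levelRist hw hb)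
    -- The conjugate `c = g a⁻¹ g⁻¹` lives below `g • w ≠ w`, so `[a c, b] = [a, b]`, while `a c =
    -- [a, g]` lies in `N`.
    have hc : Commute (g * a⁻¹ * g⁻¹) b :=
      commute_of_mem_rist_of_ne (conj_mem_rist g (inv_mem ha)) hb (length_smul g w) hgw
    have hn₁ : a * (g * a⁻¹ * g⁻¹) ∈ N := by
      simpa [mul_assoc] using mul_mem (hN g hg a ha') (inv_mem hg)
    have hn₂ := mul_mem hn₁ (hN _ (inv_mem hn₁) b hb')
    have e : a * (g * a⁻¹ * g⁻¹) * (b * (a * (g * a⁻¹ * g⁻¹))⁻¹ * b⁻¹) = a * b * a⁻¹ * b⁻¹ := by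
      calc _ = a * ((g * a⁻¹ * g⁻¹) * b) * (g * a⁻¹ * g⁻¹)⁻¹ * a⁻¹ * b⁻¹ := by group
        _ = _ := by rw [hc.eq]; group
    rwa [e] at hn₂
  have h₂ : ∀ w : TreeVertex A, w.length = m → ∀ b ∈ rist G w, ∀ x ∈ levelRist G m,
      x * b * x⁻¹ * b⁻¹ ∈ N := by
    intro w hw b hb x hx
    have : levelRist G m ≤ relativeCentralizer N K hN b := by
      rw [levelRist_le_iff]
      intro v hv a ha
      refine ⟨hK (rist_le_levelRist hv ha), ?_⟩
      obtain rfl | hne := eq_or_ne v w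
      · exact h₁ v hv a ha b hb
      · rw [(commute_of_mem_rist_of_ne ha hb (hv.trans hw.symm) hne).eq]
        simp [one_mem]
    exact (this hx).2
  intro x hx y hy
  have : levelRist G m ≤ relativeCentralizer N K hN y := by
    rw [levelRist_le_iff]
    intro v hv a ha
    refine ⟨hK (rist_le_levelRist hv ha), ?_⟩
    simpa [mul_assoc] using inv_mem (h₂ v hv a ha y hy)
  exact (this hx).2

/-- If `N` is normalised by a finite index subgroup `K` of a spherically transitive group and acts
nontrivially below every vertex, then it moves all the vertices of some level. -/
theorem exists_level_smul_ne (hG : SphericallyTransitive G) {N K : Subgroup G} [K.FiniteIndex]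
    [∀ i, Nonempty (A i)] (hN : ∀ x ∈ N, ∀ k ∈ K, k * x * k⁻¹ ∈ N)
    (hrist : ∀ v : TreeVertex A, ∃ g ∈ N, g ∈ rist G v ∧ g ≠ 1) (n : ℕ) :
    ∃ m ≥ n, ∀ w : TreeVertex A, w.length = m → ∃ g ∈ N, g • w ≠ w := by
  classical
  have hmoved : ∀ v : TreeVertex A, ∃ w, v ≤ w ∧ ∃ x ∈ N, x • w ≠ w := by
    intro v
    obtain ⟨g, hgN, hgv, hg⟩ := hrist v
    obtain ⟨w, hw⟩ := exists_smul_ne_of_ne_one hg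
    exact ⟨w, by_contra fun h => hw (mem_rist.1 hgv w h), g, hgN, hw⟩
  -- Descendants of moved vertices are moved, so finitely many translates can be treated one after
  -- another by descending.
  have key : ∀ (S : Finset G) (v : TreeVertex A), ∃ w, v ≤ w ∧
      ∀ g ∈ S, ∃ x ∈ N, x • (g⁻¹ • w) ≠ g⁻¹ • w := by
    intro S
    induction S using Finset.induction_on with
    | empty => exact fun v => ⟨v, le_rfl, by simp⟩
    | insert g S _ ih =>
      intro v
      obtain ⟨w, hvw, hw⟩ := ih v
      obtain ⟨u, hwu, x, hx, hxu⟩ := hmoved (g⁻¹ • w)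
      have hwu' : w ≤ g • u := by simpa using smul_le_smul_of_le g hwu
      refine ⟨g • u, hvw.trans hwu', fun k hk => ?_⟩
      obtain rfl | hk := Finset.mem_insert.1 hk
      · exact ⟨x, hx, by simpa using hxu⟩
      · obtain ⟨y, hy, hyw⟩ := hw k hk
        exact ⟨y, hy, smul_ne_self_of_le (smul_le_smul_of_le _ hwu') hyw⟩
  have := Fintype.ofFinite (G ⧸ K)
  obtain ⟨v, -, hv⟩ := (root A).exists_ge_length_eq (Nat.zero_le n)
  obtain ⟨w, hvw, hw⟩ := key (Finset.univ.image fun q : G ⧸ K => q.out) v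
  refine ⟨w.length, hv ▸ length_le_of_le hvw, fun w' hw' => ?_⟩
  obtain ⟨g, rfl⟩ := hG _ w w' rfl hw'
  obtain ⟨x, hx, hxw⟩ := hw ((g⁻¹ : G) : G ⧸ K).out (Finset.mem_image_of_mem _ (Finset.mem_univ _))
  have hk : ((g⁻¹ : G) : G ⧸ K).out⁻¹ * g⁻¹ ∈ K := QuotientGroup.eq.1 (QuotientGroup.out_eq' _)
  set t := ((g⁻¹ : G) : G ⧸ K).out
  -- With `k = t⁻¹ g⁻¹ ∈ K`, the vertex `g • w` is `k⁻¹ • (t⁻¹ • w)`, so `k⁻¹ x k` moves it.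
  refine ⟨_, hN x hx _ (inv_mem hk), fun e => hxw ?_⟩
  have e' : x • t⁻¹ • w = (t⁻¹ * g⁻¹) • ((t⁻¹ * g⁻¹)⁻¹ * x * (t⁻¹ * g⁻¹)⁻¹⁻¹) • g • w := by
    simp only [← mul_smul]
    congr 1
    group
  rw [e', e, ← mul_smul]
  congr 1
  group

/-- A nonempty set of vertices of level `n` which is invariant under a finite index subgroup of a
spherically transitive group has at least `2 ^ n / [G : K]` elements. -/
theorem two_pow_le_index_mul_ncard [∀ i, Finite (A i)] (hA : ∀ i, 2 ≤ Nat.card (A i))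
    (hG : SphericallyTransitive G) {K : Subgroup G} [K.FiniteIndex] {n : ℕ}
    {B : Set (TreeVertex A)} (hB : ∀ s ∈ B, s.length = n) (hBK : ∀ k ∈ K, ∀ s ∈ B, k • s ∈ B)
    (hne : B.Nonempty) : 2 ^ n ≤ K.index * B.ncard := by
  obtain ⟨s, hs⟩ := hne
  have hfin : Finite B := Finite.of_injective
    (fun b : B => (⟨b.1, hB b.1 b.2⟩ : {v : TreeVertex A // v.length = n}))
    fun a b h => Subtype.ext (congrArg (fun z => z.1) h)
  refine (two_pow_le_card_level hA n).trans ?_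
  rw [Subgroup.index, ← Nat.card_coe_set_eq, ← Nat.card_prod]
  refine Nat.card_le_card_of_surjective
    (fun p : (G ⧸ K) × B => ⟨p.1.out • p.2.1, by rw [length_smul, hB _ p.2.2]⟩) ?_
  rintro ⟨t, ht⟩
  obtain ⟨g, rfl⟩ := hG n s t (hB s hs) ht
  have hk : (g : G ⧸ K).out⁻¹ * g ∈ K := QuotientGroup.eq.1 (QuotientGroup.out_eq' _)
  refine ⟨((g : G ⧸ K), ⟨_, hBK _ hk s hs⟩), Subtype.ext ?_⟩
  change (g : G ⧸ K).out • ((g : G ⧸ K).out⁻¹ * g) • s = g • s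
  rw [← mul_smul, mul_inv_cancel_left]

/-! ### Local membership in `H` and bad vertices. -/

/-- On the descendants of `s`, the element `x` acts as some element of `H ∩ rist_G(n)`. -/
def LocallyIn (H : Subgroup G) (n : ℕ) (s : TreeVertex A) (x : G) : Prop :=
  ∃ h ∈ H ⊓ levelRist G n, ∀ w, s ≤ w → x • w = h • w

section LocallyIn

variable {H : Subgroup G} {n : ℕ} {s : TreeVertex A} {x y : G}

theorem locallyIn_of_mem (h : x ∈ H ⊓ levelRist G n) : LocallyIn H n s x := ⟨x, h, fun _ _ => rfl⟩

theorem LocallyIn.mul (hs : s.length = n) (hx : LocallyIn H n s x) (hy : LocallyIn H n s y) :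
    LocallyIn H n s (x * y) := by
  obtain ⟨h, hh, e⟩ := hx
  obtain ⟨k, hk, e'⟩ := hy
  refine ⟨h * k, mul_mem hh hk, fun w hw => ?_⟩
  rw [mul_smul, mul_smul, e' w hw, e _ (le_smul_of_mem_levelRist hk.2 hs hw)]

theorem LocallyIn.inv (hs : s.length = n) (hx : LocallyIn H n s x) : LocallyIn H n s x⁻¹ := by
  obtain ⟨h, hh, e⟩ := hx
  refine ⟨h⁻¹, inv_mem hh, fun w hw => ?_⟩
  rw [inv_smul_eq_iff, e _ (le_smul_of_mem_levelRist ((levelRist G n).inv_mem hh.2) hs hw), smul_inv_smul]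

theorem locallyIn_mul_iff_left (hs : s.length = n) (hy : LocallyIn H n s y) :
    LocallyIn H n s (x * y) ↔ LocallyIn H n s x :=
  ⟨fun h => by simpa using h.mul hs (hy.inv hs), fun h => h.mul hs hy⟩

theorem locallyIn_mul_iff_right (hs : s.length = n) (hx : LocallyIn H n s x) :
    LocallyIn H n s (x * y) ↔ LocallyIn H n s y :=
  ⟨fun h => by simpa using (hx.inv hs).mul hs h, fun h => hx.mul hs h⟩

theorem LocallyIn.conj {h : G} (hh : h ∈ H) (hx : LocallyIn H n s x) :
    LocallyIn H n (h • s) (h * x * h⁻¹) := by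
  obtain ⟨k, hk, e⟩ := hx
  refine ⟨h * k * h⁻¹, ⟨H.mul_mem (H.mul_mem hh hk.1) (H.inv_mem hh),
    (levelRist_normal n).conj_mem k hk.2 h⟩, fun w hw => ?_⟩
  have : s ≤ h⁻¹ • w := by simpa using smul_le_smul_of_le h⁻¹ hw
  rw [mul_smul, mul_smul, mul_smul, mul_smul, e _ this]

theorem locallyIn_conj_iff {h : G} (hh : h ∈ H) :
    LocallyIn H n (h • s) (h * x * h⁻¹) ↔ LocallyIn H n s x :=
  ⟨fun H' => by simpa [mul_assoc] using H'.conj (inv_mem hh), fun H' => H'.conj hh⟩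

theorem locallyIn_of_mem_rist_of_ne {t : TreeVertex A} (hs : s.length = n) (ht : t.length = n)
    (hne : s ≠ t) (hx : x ∈ rist G t) : LocallyIn H n s x :=
  ⟨1, one_mem _, fun w hw => by
    rw [one_smul, smul_eq_self_of_mem_rist_of_ne hx (hs.trans ht.symm) hne hw]⟩

end LocallyIn

/-- The vertices of level `n` below which `x` does not act as an element of `H ∩ rist_G(n)`. -/
def badSet (H : Subgroup G) (n : ℕ) (x : G) : Set (TreeVertex A) :=
  {s | s.length = n ∧ ¬ LocallyIn H n s x}

/-- The vertices `s` of level `n` below which some element of `rist_G(s)` does not act as an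
element of `H ∩ rist_G(n)`. -/
def badVertices (H : Subgroup G) (n : ℕ) : Set (TreeVertex A) :=
  {s | s.length = n ∧ ∃ x ∈ rist G s, ¬ LocallyIn H n s x}

/-- Since `h x k = (h x h⁻¹)(h k)` with `h k ∈ H ⊓ levelRist G n`, the bad set is merely translated
by `h`. Its size is thus an invariant of the double coset. -/
theorem ncard_badSet_eq {H : Subgroup G} {n : ℕ} {x h k : G} (hx : x ∈ levelRist G n)
    (hh : h ∈ H) (hk : k ∈ H) (hy : h * x * k ∈ levelRist G n) :
    (badSet H n (h * x * k)).ncard = (badSet H n x).ncard := by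
  have hhk : h * k ∈ H ⊓ levelRist G n := by
    refine ⟨mul_mem hh hk, ?_⟩
    have := mul_mem (inv_mem ((levelRist_normal n).conj_mem x hx h)) hy
    simpa [mul_assoc] using this
  have e : h * x * k = h * x * h⁻¹ * (h * k) := by group
  have key : ∀ s : TreeVertex A, s.length = n →
      (LocallyIn H n (h • s) (h * x * k) ↔ LocallyIn H n s x) := by
    intro s hs
    rw [e, locallyIn_mul_iff_left (by simpa using hs) (locallyIn_of_mem hhk),
      locallyIn_conj_iff hh]
  have : badSet H n (h * x * k) = (fun s : TreeVertex A => h • s) '' badSet H n x := by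
    ext s
    constructor
    · rintro ⟨hs, hbad⟩
      refine ⟨h⁻¹ • s, ⟨by simpa using hs, ?_⟩, smul_inv_smul h s⟩
      rwa [← key _ (by simpa using hs), smul_inv_smul]
    · rintro ⟨t, ⟨ht, hbad⟩, rfl⟩
      exact ⟨by simpa using ht, by rwa [key t ht]⟩
  rw [this, Set.ncard_image_of_injective _ (MulAction.injective h)]

/-- Witnesses of badness at distinct vertices of a level have disjoint supports, so their product is
bad exactly at the chosen vertices. -/
theorem exists_badSet_eq (H : Subgroup G) (n : ℕ) (S : Finset (TreeVertex A))
    (hS : (S : Set (TreeVertex A)) ⊆ badVertices H n) :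
    ∃ y ∈ levelRist G n, badSet H n y = S := by
  classical
  induction S using Finset.induction_on with
  | empty =>
    refine ⟨1, one_mem _, ?_⟩
    ext s
    simpa [badSet] using fun _ => locallyIn_of_mem (one_mem _)
  | insert s S hs ih =>
    rw [Finset.coe_insert, Set.insert_subset_iff] at hS
    obtain ⟨y, hy, e⟩ := ih hS.2
    obtain ⟨hsn, x, hx, hbad⟩ := hS.1
    refine ⟨y * x, mul_mem hy (rist_le_levelRist hsn hx), ?_⟩
    ext t
    have ht : t ∈ badSet H n y ↔ t ∈ S := by rw [e, Finset.mem_coe]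
    rw [Finset.coe_insert, Set.mem_insert_iff, Finset.mem_coe, ← ht]
    obtain rfl | hne := eq_or_ne t s
    · have hty : LocallyIn H n t y := by
        by_contra h
        exact hs (ht.1 ⟨hsn, h⟩)
      simp [badSet, hsn, locallyIn_mul_iff_right hsn hty, hbad]
    · simp only [badSet, Set.mem_ofPred_eq, hne, false_or]
      refine and_congr_right fun htn => not_congr ?_
      exact locallyIn_mul_iff_left htn (locallyIn_of_mem_rist_of_ne htn hsn hne hx)

/-- Every size from `0` to the number of bad vertices is the size of some bad set, and different
sizes lie in different double cosets. Counting the size `0` makes the inequality strict. -/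
theorem ncard_badVertices_lt [∀ i, Finite (A i)] {H : Subgroup G} (hH : H.FiniteBiIndex) (n : ℕ) :
    (badVertices H n).ncard < Nat.card (DoubleCoset.Quotient (H : Set G) (H : Set G)) := by
  have : Finite (DoubleCoset.Quotient (H : Set G) (H : Set G)) := hH
  have hfin : (badVertices H n).Finite :=
    (Set.toFinite (Set.range fun v : {v : TreeVertex A // v.length = n} => v.1)).subset
      fun s hs => ⟨⟨s, hs.1⟩, rfl⟩
  have hex : ∀ j : Fin ((badVertices H n).ncard + 1), ∃ y ∈ levelRist G n,
      (badSet H n y).ncard = j := by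
    intro j
    have hj : j.1 ≤ hfin.toFinset.card := by
      rw [← Set.ncard_eq_toFinset_card _ hfin]
      omega
    obtain ⟨S, hS, hcard⟩ := Finset.exists_subset_card_eq hj
    obtain ⟨y, hy, e⟩ := exists_badSet_eq H n S fun s hs => hfin.mem_toFinset.1 (hS hs)
    exact ⟨y, hy, by rw [e, Set.ncard_coe_finset, hcard]⟩
  choose y hy hcard using hex
  have hinj : Function.Injective fun j => DoubleCoset.mk H H (y j) := by
    intro i j hij
    obtain ⟨h, hh, k, hk, e⟩ := (DoubleCoset.eq H H _ _).1 hij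
    have := ncard_badSet_eq (hy i) hh hk (e ▸ hy j)
    rw [← e, hcard, hcard] at this
    exact Fin.ext this.symm
  simpa using Nat.card_le_card_of_injective _ hinj

theorem locallyIn_of_badVertices_eq_empty {H : Subgroup G} {n : ℕ} (hB : badVertices H n = ∅)
    {s : TreeVertex A} (hs : s.length = n) {x : G} (hx : x ∈ levelRist G n) :
    LocallyIn H n s x := by
  let J : Subgroup G :=
    { carrier := {x | LocallyIn H n s x}
      one_mem' := locallyIn_of_mem (one_mem _)
      mul_mem' := fun ha hb => ha.mul hs hb
      inv_mem' := fun ha => ha.inv hs }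
  have : levelRist G n ≤ J := by
    rw [levelRist_le_iff]
    intro t ht a ha
    obtain rfl | hne := eq_or_ne s t
    · by_contra hbad
      exact (Set.ext_iff.1 hB s).1 ⟨hs, a, ha, hbad⟩
    · exact locallyIn_of_mem_rist_of_ne hs ht hne ha
  exact this hx

/-- Write `k = h * l`: below `s`, where `c` is supported, `l` agrees with some `h' ∈ H`, so `k` and
`h * h'` conjugate `c` identically. -/
theorem conj_mem_of_badVertices_eq_empty {H : Subgroup G} {n : ℕ} (hB : badVertices H n = ∅)
    {s : TreeVertex A} (hs : s.length = n) {c k : G} (hc : c ∈ rist G s) (hcH : c ∈ H)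
    (hk : k ∈ H ⊔ levelRist G n) : k * c * k⁻¹ ∈ H := by
  obtain ⟨h, hh, l, hl, rfl⟩ := Subgroup.mem_sup_of_normal_right.1 hk
  obtain ⟨h', hh', e⟩ := locallyIn_of_badVertices_eq_empty hB hs hl
  have hcomm : Commute (h'⁻¹ * l) c := commute_of_mem_rist hc fun w hw => by
    rw [mul_smul, e w hw, inv_smul_smul]
  have : h * l * c * (h * l)⁻¹ = (h * h') * c * (h * h')⁻¹ := by
    calc h * l * c * (h * l)⁻¹ = h * h' * ((h'⁻¹ * l) * c) * (h'⁻¹ * l)⁻¹ * (h * h')⁻¹ := by group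
      _ = _ := by rw [hcomm.eq]; group
  rw [this]
  exact mul_mem (mul_mem (mul_mem hh hh'.1) hcH) (inv_mem (mul_mem hh hh'.1))

/-! ### Nontrivial intersection with rigid stabilisers. -/

/-- A subgroup of finite bi-index and infinite index of a branch group meets all the rigid vertex
stabilisers nontrivially. -/
theorem exists_mem_rist_ne_one [∀ i, Nonempty (A i)] (hG : IsBranchGroup G) {H : Subgroup G}
    (hH : H.FiniteBiIndex) (hinf : ¬ H.FiniteIndex) (v : TreeVertex A) :
    ∃ c ∈ H, c ∈ rist G v ∧ c ≠ 1 := by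
  by_contra! hbot
  have := hG.finiteIndex_levelRist v.length
  obtain ⟨F, hF, -, hcover⟩ := hH.exists_finite_inf (levelRist G v.length)
  have hlevel : ∀ f : G, ∃ m : ℕ, ∀ a ∈ rist G v, a ∈ levelRist G m →
      (∃ h ∈ H ⊓ levelRist G v.length, ∃ k ∈ H ⊓ levelRist G v.length, a = h * f * k) →
      a = 1 := by
    intro f
    by_cases hf : ∃ a ∈ rist G v, a ≠ 1 ∧
      ∃ h ∈ H ⊓ levelRist G v.length, ∃ k ∈ H ⊓ levelRist G v.length, a = h * f * k
    · obtain ⟨a, ha, ha1, h, hh, k, hk, e⟩ := hf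
      obtain ⟨w, hw⟩ := exists_smul_ne_of_ne_one ha1
      refine ⟨w.length, ?_⟩
      rintro b hb hbm ⟨h', hh', k', hk', e'⟩
      exfalso
      set g := h' * h⁻¹ with hg
      have hgmem : g ∈ H ⊓ levelRist G v.length := mul_mem hh' (inv_mem hh)
      have hconj : g * a * g⁻¹ ∈ rist G v := by
        have := conj_mem_rist g ha
        rwa [smul_eq_self_of_mem_levelRist hgmem.2 rfl] at this
      -- The factor `f` cancels, leaving an element of `H ∩ rist G v`, which is trivial by
      -- assumption. So `b` is the conjugate of `a` by `g`; as `b` fixes the level of `w`, `a` would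
      -- fix `w`.
      have hprod : (g * a * g⁻¹)⁻¹ * b = g * (k⁻¹ * k') := by
        rw [e, e', hg]; group
      have hone := hbot ((g * a * g⁻¹)⁻¹ * b)
        (by rw [hprod]; exact mul_mem hgmem.1 (mul_mem (inv_mem hk.1) hk'.1))
        (mul_mem (inv_mem hconj) hb)
      have hbg : g * a * g⁻¹ = b := by rwa [inv_mul_eq_one] at hone
      have := smul_eq_self_of_mem_levelRist hbm (v := g • w) (length_smul g w)
      rw [← hbg, mul_smul, inv_smul_smul, mul_smul] at this
      exact hw (MulAction.injective g this)
    · push Not at hf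
      refine ⟨0, fun a ha _ => ?_⟩
      rintro ⟨h, hh, k, hk, e⟩
      by_contra ha1
      exact hf a ha ha1 h hh k hk e
  choose m hm using hlevel
  obtain ⟨M, hM⟩ := (hF.image m).bddAbove
  have htriv : ∀ a ∈ rist G v, a ∈ levelRist G (max M v.length) → a = 1 := by
    intro a ha haM
    obtain ⟨f, hf, hfa⟩ := hcover a (rist_le_levelRist rfl ha)
    exact hm f a ha (levelRist_antitone
      ((hM (Set.mem_image_of_mem m hf)).trans (le_max_left _ _)) haM) hfa
  -- Transitivity carries the triviality below `v` to the whole level; then `⊥` has finite index,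
  -- hence so does `H`.
  have hlev : levelRist G (max M v.length) ≤ ⊥ := by
    rw [levelRist_le_iff]
    intro w hw x hx
    obtain ⟨u, hvu, hu⟩ := v.exists_ge_length_eq (le_max_right M v.length)
    obtain ⟨g, rfl⟩ := hG.sphericallyTransitive _ w u hw hu
    have hgx := conj_mem_rist g hx
    have := htriv _ (rist_le_rist_of_le hvu hgx) (rist_le_levelRist hu hgx)
    simpa using this
  have := hG.finiteIndex_levelRist (max M v.length)
  exact hinf (Subgroup.finiteIndex_of_le (hlev.trans bot_le))

end BranchGroups

/-! ### Conclusion. -/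

theorem mainTheorem2 {A : ℕ → Type u} [∀ i, Finite (A i)] (hA : ∀ i, 2 ≤ Nat.card (A i))
    (G : Subgroup (rootedTreeAut A)) (hG : IsBranchGroup G) :
    PropertyBF G := by
  intro H hH
  by_contra hinf
  have hne : ∀ i, Nonempty (A i) := fun i =>
    (Nat.card_pos_iff.1 (lt_of_lt_of_le two_pos (hA i))).1
  obtain ⟨n₀, hn₀⟩ := hH.exists_sup_eq (levelRist_antitone (G := G))
  set K := H ⊔ levelRist G n₀ with hKdef
  have := hG.finiteIndex_levelRist n₀
  have hK : K.FiniteIndex := Subgroup.finiteIndex_of_le le_sup_right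
  have hHK : H ≤ K := le_sup_left
  have hempty : ∃ n₁ ≥ n₀, ∀ n ≥ n₁, badVertices H n = ∅ := by
    -- Beyond this bound, a nonempty bad set would give `2 ^ n ≤ [G : K] · |H \ G / H| ≤ n`.
    refine ⟨max n₀ (K.index * Nat.card (DoubleCoset.Quotient (H : Set G) (H : Set G))),
      le_max_left _ _, fun n hn => ?_⟩
    by_contra hB
    have hinv : ∀ k ∈ K, ∀ s ∈ badVertices H n, k • s ∈ badVertices H n := by
      rintro k hk s ⟨hs, x, hx, hbad⟩
      rw [← hn₀ n ((le_max_left _ _).trans hn)] at hk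
      obtain ⟨h, hh, l, hl, rfl⟩ := Subgroup.mem_sup_of_normal_right.1 hk
      rw [mul_smul, smul_eq_self_of_mem_levelRist hl hs]
      exact ⟨by simpa using hs, _, conj_mem_rist h hx, by rwa [locallyIn_conj_iff hh]⟩
    have h₁ := two_pow_le_index_mul_ncard hA hG.sphericallyTransitive (K := K) (n := n)
      (fun s hs => hs.1) hinv (Set.nonempty_iff_ne_empty.2 hB)
    have h₂ := Nat.mul_le_mul_left K.index (ncard_badVertices_lt hH n).le
    have h₃ := (le_max_right _ _).trans hn
    exact absurd Nat.lt_two_pow_self (not_lt.2 (h₁.trans (h₂.trans h₃)))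
  obtain ⟨n₁, hn₁, hempty⟩ := hempty
  have hN : ∀ x ∈ relativeCore H K, ∀ k ∈ K, k * x * k⁻¹ ∈ relativeCore H K :=
    fun x hx k hk => conj_mem_relativeCore hx hk
  have hrist : ∀ v : TreeVertex A, ∃ g ∈ relativeCore H K, g ∈ rist G v ∧ g ≠ 1 := by
    intro v
    -- Descend to a level without bad vertices, where `K` conjugates elements of `H ∩ rist G w` into
    -- `H`.
    obtain ⟨w, hvw, hw⟩ := v.exists_ge_length_eq (le_max_left v.length n₁)
    obtain ⟨c, hcH, hc, hc1⟩ := exists_mem_rist_ne_one hG hH hinf w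
    refine ⟨c, fun k hk => ?_, rist_le_rist_of_le hvw hc, hc1⟩
    rw [← hn₀ _ (hn₁.trans (le_max_right v.length n₁))] at hk
    exact conj_mem_of_badVertices_eq_empty (hempty _ (le_max_right _ _)) hw hc hcH hk
  obtain ⟨m, hm, hmove⟩ := exists_level_smul_ne hG.sphericallyTransitive hN hrist n₀
  have := hG.finiteIndex_levelRist m
  refine hinf (hH.finiteIndex_of_commutator_mem (levelRist G m) fun x hx y hy => ?_)
  exact relativeCore_le H K (commutator_mem_of_smul_ne hN
    ((levelRist_antitone hm).trans le_sup_right) hmove x hx y hy)
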